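/- Let $P\subset\mathbb{R}^d$ be a $d$-dimensional polytope with vertices $p_1,\dots,p_v$ and facet inequalities $\langle W_j,x\rangle\le w_j$, $j=1,\dots,f$ (one inequality for each facet). Let $S_P\in\mathbb{R}^{v\times f}$ be its slack matrix, with entries $(S_P)_{ij}=w_j-\langle W_j,p_i\rangle$, and let $S_P(\mathbf{x})$ be the symbolic slack matrix obtained from $S_P$ by replacing its nonzero entries by distinct variables $x_1,\dots,x_t$. The slack ideal of $P$ is $$I_P=\langle (d+2)\text{-minors of }S_P(\mathbf{x})\rangle:\Bigl(\prod_{i=1}^t x_i\Bigr)^{\infty}\subset\mathbb{C}[x_1,\dots,x_t].$$ For an integer matrix $\mathcal{A}\in\mathbb{Z}^{n\times t}$ with columns $a_1,\dots,a_t$, the toric ideal of $\mathcal{A}$ is the kernel of the $\mathbb{C}$-algebra homomorphism $\mathbb{C}[x_1,\dots,x_t]\to\mathbb{C}[t_1^{\pm1},\dots,t_n^{\pm1}]$, $x_j\mapsto \mathbf{t}^{a_j}$; an ideal of $\mathbb{C}[x_1,\dots,x_t]$ is called toric if it is the toric ideal of some such matrix. Let $G_P$ be the non-incidence graph of $P$: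 the bipartite graph on the vertices and facets of $P$ in which a vertex is joined to a facet if and only if it does not lie on it, so that the edges of $G_P$ are labelled by the variables of $S_P(\mathbf{x})$. Let $T_P\subset\mathbb{C}[x_1,\dots,x_t]$ be the toric ideal of the vertex-edge incidence matrix of $G_P$. The slack ideal $I_P$ is called graphic if $I_P=T_P$. **Proposition.** If $P$ has $d+2$ vertices or $d+2$ facets, then $I_P=T_P$. Thus $I_P$ is graphic, and in particular toric. -/

import Mathlib

noncomputable section

/-- `F` is a facet of `P ⊆ ℝ^d`: a nonempty (exposed) face of dimension `d - 1`. -/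
def IsFacet {d : ℕ} (P F : Set (EuclideanSpace ℝ (Fin d))) : Prop :=
  IsExposed ℝ P F ∧ F.Nonempty ∧ Module.finrank ℝ (vectorSpan ℝ F) + 1 = d

/-- A `d`-dimensional polytope in `ℝ^d` with `v` labelled vertices and `f` labelled facet
inequalities `⟨normal j, x⟩ ≤ offset j`. -/
structure LabelledPolytope (d v f : ℕ) where
  /-- the polytope, as a set of points -/
  carrier : Set (EuclideanSpace ℝ (Fin d))
  /-- the vertices -/
  vertex : Fin v → EuclideanSpace ℝ (Fin d)
  /-- the left-hand sides of the facet inequalities -/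
  normal : Fin f → EuclideanSpace ℝ (Fin d)
  /-- the right-hand sides of the facet inequalities -/
  offset : Fin f → ℝ
  carrier_eq : carrier = convexHull ℝ (Set.range vertex)
  affineSpan_carrier : affineSpan ℝ carrier = ⊤
  vertex_injective : Function.Injective vertex
  range_vertex : Set.range vertex = carrier.extremePoints ℝ
  inner_le_offset : ∀ j, ∀ x ∈ carrier, inner ℝ (normal j) x ≤ offset j
  facet_injective :
    Function.Injective fun j ↦ {x | x ∈ carrier ∧ inner ℝ (normal j) x = offset j}
  range_facet :
    Set.range (fun j ↦ {x | x ∈ carrier ∧ inner ℝ (normal j) x = offset j}) =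
      {F | IsFacet carrier F}

/-- The saturation `J : g^∞` of an ideal `J` by an element `g`. -/
def idealSaturation {R : Type*} [CommRing R] (J : Ideal R) (g : R) : Ideal R where
  carrier := {p | ∃ k : ℕ, g ^ k * p ∈ J}
  zero_mem' := ⟨0, by simp⟩
  add_mem' := by
    rintro a b ⟨k, hk⟩ ⟨l, hl⟩
    refine ⟨k + l, ?_⟩
    have h : g ^ (k + l) * (a + b) = g ^ l * (g ^ k * a) + g ^ k * (g ^ l * b) := by ring
    rw [h]
    exact J.add_mem (J.mul_mem_left _ hk) (J.mul_mem_left _ hl)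
  smul_mem' := by
    rintro c a ⟨k, hk⟩
    refine ⟨k, ?_⟩
    have h : g ^ k * (c • a) = c * (g ^ k * a) := by rw [smul_eq_mul]; ring
    rw [h]
    exact J.mul_mem_left _ hk

/-- The ideal generated by the `k`-minors of a matrix. -/
def minorIdeal {R : Type*} [CommRing R] {m n : ℕ} (k : ℕ) (M : Matrix (Fin m) (Fin n) R) :
    Ideal R :=
  Ideal.span {p | ∃ (r : Fin k ↪o Fin m) (c : Fin k ↪o Fin n), p = (M.submatrix r c).det}

/-- The toric ideal of an integer matrix `A`: the kernel of the `ℂ`-algebra homomorphism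
`x_j ↦ t^{a_j}`, where `a_j` is the `j`-th column of `A`. For a finite row index type `ι`, the
ring of Laurent polynomials in the variables `t_i`, `i ∈ ι`, is the group algebra of `ι → ℤ`. -/
def toricIdeal {ι σ : Type*} [Finite ι] (A : Matrix ι σ ℤ) : Ideal (MvPolynomial σ ℂ) :=
  RingHom.ker (MvPolynomial.aeval (R := ℂ)
    fun j ↦ (AddMonoidAlgebra.single (fun i ↦ A i j) 1 : AddMonoidAlgebra ℂ (ι → ℤ)))

/-- An ideal of a polynomial ring is toric if it is the toric ideal of some point configuration
in some `ℤ^n`. -/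
def IsToric {σ : Type*} (I : Ideal (MvPolynomial σ ℂ)) : Prop :=
  ∃ (n : ℕ) (A : Matrix (Fin n) σ ℤ), I = toricIdeal A

namespace LabelledPolytope

variable {d v f : ℕ} (P : LabelledPolytope d v f)

/-- The `j`-th facet. -/
def facet (j : Fin f) : Set (EuclideanSpace ℝ (Fin d)) :=
  {x | x ∈ P.carrier ∧ inner ℝ (P.normal j) x = P.offset j}

/-- The slack matrix: its `(i, j)` entry is the slack of the `i`-th vertex with respect to the
`j`-th facet inequality. -/
def slackMatrix : Matrix (Fin v) (Fin f) ℝ :=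
  Matrix.of fun i j ↦ P.offset j - inner ℝ (P.normal j) (P.vertex i)

/-- The variables of the symbolic slack matrix: one for each nonzero entry of the slack matrix. -/
abbrev Var : Type := {e : Fin v × Fin f // P.slackMatrix e.1 e.2 ≠ 0}

open Classical in
/-- The symbolic slack matrix. -/
def symbolicSlackMatrix : Matrix (Fin v) (Fin f) (MvPolynomial P.Var ℂ) :=
  Matrix.of fun i j ↦
    if h : P.slackMatrix i j ≠ 0 then MvPolynomial.X (⟨(i, j), h⟩ : P.Var) else 0

open Classical in
/-- The slack ideal: the saturation, by the product of all variables, of the ideal of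
`(d + 2)`-minors of the symbolic slack matrix. -/
def slackIdeal : Ideal (MvPolynomial P.Var ℂ) :=
  idealSaturation (minorIdeal (d + 2) P.symbolicSlackMatrix) (∏ x : P.Var, MvPolynomial.X x)

/-- The non-incidence graph: the bipartite graph on the vertices and facets of `P` in which a
vertex is adjacent to a facet if and only if it does not lie on it. -/
def nonIncidenceGraph : SimpleGraph (Fin v ⊕ Fin f) :=
  SimpleGraph.fromRel fun a b ↦ ∃ i j, a = Sum.inl i ∧ b = Sum.inr j ∧ P.vertex i ∉ P.facet j

theorem slackMatrix_ne_zero_iff (i : Fin v) (j : Fin f) :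
    P.slackMatrix i j ≠ 0 ↔ P.vertex i ∉ P.facet j := by
  have hi : P.vertex i ∈ P.carrier := by
    rw [P.carrier_eq]
    exact subset_convexHull ℝ _ ⟨i, rfl⟩
  simp only [slackMatrix, facet, Matrix.of_apply, Set.mem_ofPred_eq, hi, true_and, ne_eq,
    sub_eq_zero]
  exact not_congr eq_comm

theorem nonIncidenceGraph_adj_iff (i : Fin v) (j : Fin f) :
    P.nonIncidenceGraph.Adj (Sum.inl i) (Sum.inr j) ↔ P.vertex i ∉ P.facet j := by
  simp [nonIncidenceGraph, SimpleGraph.fromRel_adj]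

/-- The edges of the non-incidence graph are labelled by the variables of the symbolic slack
matrix: the variable in position `(i, j)` labels the edge from vertex `i` to facet `j`. -/
def varEquivEdge : P.Var ≃ P.nonIncidenceGraph.edgeSet :=
  Equiv.ofBijective
    (fun e ↦ ⟨s(Sum.inl e.1.1, Sum.inr e.1.2), by
      rw [SimpleGraph.mem_edgeSet, nonIncidenceGraph_adj_iff, ← slackMatrix_ne_zero_iff]
      exact e.2⟩)
    (by
      constructor
      · rintro ⟨⟨i, j⟩, h⟩ ⟨⟨i', j'⟩, h'⟩ hij
        simpa using hij
      · rintro ⟨e, he⟩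
        induction e using Sym2.ind with
        | _ a b =>
          have hab := he
          rw [SimpleGraph.mem_edgeSet, nonIncidenceGraph, SimpleGraph.fromRel_adj] at hab
          obtain ⟨-, ⟨i, j, rfl, rfl, hij⟩ | ⟨i, j, rfl, rfl, hij⟩⟩ := hab
          · exact ⟨⟨(i, j), (P.slackMatrix_ne_zero_iff i j).2 hij⟩, rfl⟩
          · exact ⟨⟨(i, j), (P.slackMatrix_ne_zero_iff i j).2 hij⟩, Subtype.ext Sym2.eq_swap⟩)

open Classical in
/-- The vertex-edge incidence matrix of the non-incidence graph, its columns being labelled by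
the variables of the symbolic slack matrix. -/
def incidenceMatrix : Matrix (Fin v ⊕ Fin f) P.Var ℤ :=
  Matrix.of fun a x ↦ P.nonIncidenceGraph.incMatrix ℤ a (P.varEquivEdge x)

/-- The toric ideal of the non-incidence graph of `P`. -/
def graphToricIdeal : Ideal (MvPolynomial P.Var ℂ) :=
  toricIdeal P.incidenceMatrix

/-- The slack ideal of `P` is graphic. -/
def IsGraphic : Prop :=
  P.slackIdeal = P.graphToricIdeal

end LabelledPolytope

end

/-!
Suppose that `P` has `d + 2` vertices; the case of `d + 2` facets is the same with the slack matrix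
transposed. The slack vectors `(w - ⟨W, p_i⟩)_i` of all affine functions form a hyperplane of
`ℝ^(d+2)`, orthogonal to the affine dependence `l` of the vertices
(`exists_range_eq_dotProduct_eq_zero`). The columns of the slack matrix are, up to scaling, the
vectors on the extreme rays of the cone of nonnegative vectors of this hyperplane (`IsCocircuit`),
and for a hyperplane these are easily listed: their supports are the singletons `{i}` with `l i = 0`
and the pairs `{a, b}` with `l b < 0 < l a` (`isCircuitPattern_of_isCocircuit`). So the support of the
slack matrix is, apart from the singletons, the incidence matrix of a complete bipartite graph.

For `d + 2` facets the hyperplane consists of the slack vectors of points in homogeneous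
coordinates, and its extreme rays correspond to the vertices. This uses that a polytope is the
intersection of its facet half-spaces (`LabelledPolytope.exists_offset_lt_inner`).

For such a pattern the two ideals are compared as follows.
* The variables of the toric ideal become `t_i s_j`, so that modulo `T_P` the symbolic slack matrix is
  a scaling of the `0/1` pattern matrix, whose maximal minors vanish because the signs of `l` form a
  left kernel vector. As variables are units in the Laurent polynomial ring, the saturation lies in
  `T_P` too.
* Conversely, over any commutative ring, a matrix with unit entries on the pattern and vanishing
  maximal minors can be scaled to the `0/1` pattern (`IsCircuitPattern.exists_units_mul`): scale along
  a spanning tree of the bipartite graph; the minor on the tree and one more column shows that the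
  remaining entries of that column agree as well. Over the localization of
  `ℂ[x] ⧸ (minors)` at the product of the variables this says that the localization map factors through
  the Laurent polynomial ring by `x_ij ↦ t_i s_j`, so it kills `T_P`; its kernel is `I_P`. No generators
  of the toric ideal are needed.
-/

open Matrix

/-! ### Matrices supported on a circuit pattern -/

/-- `E : ρ → κ → Prop`, the support relation of a `ρ × κ` matrix, is the pattern of cocircuits
orthogonal to the vector `l`: the column supports are exactly the singletons `{i}` with `l i = 0` and
the pairs `{a, b}` with `l b < 0 < l a`, and pairs of the second kind exist. -/
structure IsCircuitPattern {ρ κ : Type*} (E : ρ → κ → Prop) (l : ρ → ℝ) : Prop where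
  exists_pos : ∃ a, 0 < l a
  exists_neg : ∃ b, l b < 0
  column : ∀ k, (∃ i, l i = 0 ∧ ∀ i', E i' k ↔ i' = i) ∨
    ∃ a b, 0 < l a ∧ l b < 0 ∧ ∀ i', E i' k ↔ i' = a ∨ i' = b
  exists_singleton : ∀ i, l i = 0 → ∃ k, ∀ i', E i' k ↔ i' = i
  exists_pair : ∀ a b, 0 < l a → l b < 0 → ∃ k, ∀ i', E i' k ↔ i' = a ∨ i' = b

section Sums

variable {ρ A : Type*} [Fintype ρ] [CommRing A]

theorem sum_mul_of_support_singleton (y m : ρ → A) (i : ρ) (h : ∀ i', i' ≠ i → m i' = 0) :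
    ∑ i', y i' * m i' = y i * m i :=
  Fintype.sum_eq_single i fun i' hi' ↦ by rw [h i' hi', mul_zero]

theorem sum_mul_of_support_pair (y m : ρ → A) {a b : ρ} (hab : a ≠ b)
    (h : ∀ i', i' ≠ a ∧ i' ≠ b → m i' = 0) :
    ∑ i', y i' * m i' = y a * m a + y b * m b :=
  Fintype.sum_eq_add a b hab fun i' hi' ↦ by rw [h i' hi', mul_zero]

end Sums

namespace IsCircuitPattern

variable {ρ κ : Type*} [Fintype ρ] [DecidableEq ρ] {E : ρ → κ → Prop} {l : ρ → ℝ}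

/-- The `0/1` matrix of the pattern has no nonzero maximal minor: the vector of signs of `l` is in
its left kernel. -/
theorem det_submatrix_indicator (h : IsCircuitPattern E l) [∀ i k, Decidable (E i k)]
    (c : ρ → κ) : (Matrix.of fun i j ↦ if E i (c j) then (1 : ℤ) else 0).det = 0 := by
  rw [← exists_vecMul_eq_zero_iff]
  refine ⟨fun i ↦ (SignType.sign (l i) : ℤ), ?_, ?_⟩
  · obtain ⟨a, ha⟩ := h.exists_pos
    intro h0
    have := congrFun h0 a
    simp [sign_pos ha] at this
  · funext j
    simp only [vecMul, dotProduct, Matrix.of_apply, Pi.zero_apply]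
    rcases h.column (c j) with ⟨i, hi, hE⟩ | ⟨a, b, ha, hb, hE⟩
    · rw [sum_mul_of_support_singleton _ _ i fun i' hi' ↦ by simp [hE, hi']]
      simp [hi]
    · have hab : a ≠ b := by rintro rfl; exact lt_asymm ha hb
      rw [sum_mul_of_support_pair _ _ hab fun i' hi' ↦ by simp [hE, hi'.1, hi'.2]]
      simp [hE, sign_pos ha, sign_neg hb]

/-- A vector `y` orthogonal to the columns of a spanning tree is orthogonal to every column `k`. The
tree is given by `c`, which assigns to each `i ≠ a₀` a column: the edge from `i` to `a₀` if `l i < 0`,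
the edge from `i` to `b₀` if `0 < l i`, and the singleton `{i}` if `l i = 0`. The value `c a₀` plays no
role. Up to a unit, the minor on the tree and the column `k` is the product of `y` and this column. -/
theorem sum_mul_eq_zero_of_tree {A : Type*} [CommRing A] {M : Matrix ρ κ A} {a₀ b₀ : ρ}
    (hunit : ∀ i k, E i k → IsUnit (M i k)) (hzero : ∀ i k, ¬ E i k → M i k = 0)
    (hdet : ∀ c : ρ → κ, (M.submatrix id c).det = 0)
    (ha₀ : 0 < l a₀) (hb₀ : l b₀ < 0) (c : ρ → κ)
    (hneg : ∀ b, l b < 0 → ∀ i, E i (c b) ↔ i = a₀ ∨ i = b)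
    (hnull : ∀ i, l i = 0 → ∀ i', E i' (c i) ↔ i' = i)
    (hpos : ∀ a, a ≠ a₀ → 0 < l a → ∀ i, E i (c a) ↔ i = a ∨ i = b₀)
    (y : ρ → A) (hy₀ : IsUnit (y a₀)) (hy : ∀ i, i ≠ a₀ → ∑ i', y i' * M i' (c i) = 0) (k : κ) :
    ∑ i, y i * M i k = 0 := by
  set c' := Function.update c a₀ k with hc'
  set M' := M.submatrix id c' with hM'
  set N := M'.updateRow a₀ (Pi.single a₀ 1) with hN
  set γ := ∑ i, y i * M i k with hγ
  -- Row operations with multipliers `y` turn row `a₀` of the minor into `γ • e_{a₀}`.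
  have hrow : ∑ i, y i • M' i = γ • Pi.single a₀ (1 : A) := by
    funext j
    rw [Finset.sum_apply]
    by_cases hj : j = a₀
    · subst hj
      simp [hM', hc', hγ]
    · simpa [hM', hc', hj] using hy j hj
  have h1 : γ * N.det = 0 := by
    have := det_updateRow_sum M' a₀ y
    rw [hrow, det_updateRow_smul, hdet c', smul_zero] at this
    exact this
  have hcol : ∀ j i, N i j = if i = a₀ then (if j = a₀ then 1 else 0) else M i (c' j) := by
    intro j i
    by_cases hi : i = a₀
    · subst hi; simp [hN, Pi.single_apply]
    · simp [hN, hi, hM']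
  -- The columns of `N` span: first `e_i` for `l i ≤ 0`, then for `0 < l i`, then `e_{a₀}`.
  let R := LinearMap.range N.mulVecLin
  have hmem : ∀ j, (fun i ↦ N i j) ∈ R := fun j ↦
    ⟨Pi.single j 1, by rw [mulVecLin_apply, mulVec_single_one]; rfl⟩
  have hscale : ∀ (i : ρ) (u : A), IsUnit u → Pi.single i u ∈ R → Pi.single i (1 : A) ∈ R := by
    rintro i u ⟨u, rfl⟩ hu
    have := R.smul_mem (↑u⁻¹ : A) hu
    rwa [← Pi.single_smul, smul_eq_mul, Units.inv_mul] at this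
  have hnonpos : ∀ b, b ≠ a₀ → l b ≤ 0 → Pi.single b (1 : A) ∈ R := by
    intro b hba hb
    have hE : E b (c b) ∧ ∀ i, i ≠ a₀ → i ≠ b → ¬ E i (c b) := by
      rcases hb.lt_or_eq with hb | hb
      · exact ⟨by simp [hneg b hb], fun i h1 h2 ↦ by simp [hneg b hb, h1, h2]⟩
      · exact ⟨by simp [hnull b hb], fun i h1 h2 ↦ by simp [hnull b hb, h2]⟩
    refine hscale b (M b (c b)) (hunit _ _ hE.1) ?_
    convert hmem b using 1
    funext i
    by_cases hi : i = b
    · subst hi; simp [hcol, hc', hba]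
    · by_cases hia : i = a₀
      · subst hia; simp [hcol, hi, hba]
      · simp [hcol, hc', hba, hi, hia, hzero _ _ (hE.2 i hia hi)]
  have hb₀a : b₀ ≠ a₀ := by rintro rfl; exact lt_asymm ha₀ hb₀
  have hother : ∀ a, a ≠ a₀ → Pi.single a (1 : A) ∈ R := by
    intro a haa
    rcases le_or_gt (l a) 0 with ha | ha
    · exact hnonpos a haa ha
    have hab : a ≠ b₀ := by rintro rfl; exact lt_asymm ha hb₀
    refine hscale a (M a (c a)) (hunit _ _ (by simp [hpos a haa ha])) ?_
    have := R.sub_mem (hmem a) (R.smul_mem (M b₀ (c a)) (hnonpos b₀ hb₀a hb₀.le))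
    convert this using 1
    funext i
    by_cases hi : i = a
    · subst hi; simp [hcol, hc', haa, hab]
    · by_cases hia : i = a₀
      · subst hia; simp [hcol, hi, haa, Ne.symm hb₀a]
      · by_cases hib : i = b₀
        · subst hib; simp [hcol, hc', haa, hi, hia]
        · simp [hcol, hc', haa, hi, hia, hib, hzero i (c a) (by simp [hpos a haa ha, hi, hib])]
  have hroot : Pi.single a₀ (1 : A) ∈ R := by
    have h2 : ∑ i ∈ Finset.univ.erase a₀, M i k • Pi.single i (1 : A) ∈ R :=
      R.sum_mem fun i hi ↦ R.smul_mem _ (hother i (Finset.ne_of_mem_erase hi))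
    convert R.sub_mem (hmem a₀) h2 using 1
    funext i
    rw [Pi.sub_apply, Finset.sum_apply]
    by_cases hi : i = a₀
    · subst hi
      rw [Finset.sum_eq_zero]
      · simp [hcol]
      · intro j hj
        simp [(Finset.ne_of_mem_erase hj).symm]
    · rw [Finset.sum_eq_single i]
      · simp [hcol, hi, hc']
      · intro j _ hj
        simp [hj.symm]
      · simp [hi]
  have hsurj : Function.Surjective N.mulVec := by
    intro x
    have : x ∈ R := by
      rw [pi_eq_sum_univ' x]
      refine R.sum_mem fun i _ ↦ R.smul_mem _ ?_
      by_cases hi : i = a₀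
      · subst hi
        exact hroot
      · exact hother i hi
    exact this
  obtain ⟨B, hB⟩ := mulVec_surjective_iff_exists_right_inverse.1 hsurj
  exact (isUnit_det_of_right_inverse hB).mul_left_eq_zero.1 h1

/-- A matrix over a commutative ring whose entries are units on the pattern and zero elsewhere, and
whose maximal minors vanish, is obtained from the `0/1` matrix of the pattern by scaling rows and
columns. -/
theorem exists_units_mul (h : IsCircuitPattern E l) {A : Type*} [CommRing A] {M : Matrix ρ κ A}
    (hunit : ∀ i k, E i k → IsUnit (M i k)) (hzero : ∀ i k, ¬ E i k → M i k = 0)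
    (hdet : ∀ c : ρ → κ, (M.submatrix id c).det = 0) :
    ∃ (t : ρ → Aˣ) (s : κ → Aˣ), ∀ i k, E i k → M i k = t i * s k := by
  classical
  obtain ⟨a₀, ha₀⟩ := h.exists_pos
  obtain ⟨b₀, hb₀⟩ := h.exists_neg
  have hab₀ : a₀ ≠ b₀ := by rintro rfl; exact lt_asymm ha₀ hb₀
  have hc : ∀ i, ∃ k, (l i < 0 → ∀ i', E i' k ↔ i' = a₀ ∨ i' = i) ∧
      (l i = 0 → ∀ i', E i' k ↔ i' = i) ∧ (0 < l i → ∀ i', E i' k ↔ i' = i ∨ i' = b₀) := by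
    intro i
    rcases lt_trichotomy (l i) 0 with hi | hi | hi
    · obtain ⟨k, hk⟩ := h.exists_pair a₀ i ha₀ hi
      exact ⟨k, fun _ ↦ hk, fun h ↦ absurd h hi.ne, fun h ↦ absurd h hi.asymm⟩
    · obtain ⟨k, hk⟩ := h.exists_singleton i hi
      exact ⟨k, fun h ↦ absurd hi h.ne, fun _ ↦ hk, fun h ↦ absurd hi h.ne'⟩
    · obtain ⟨k, hk⟩ := h.exists_pair i b₀ hi hb₀
      exact ⟨k, fun h ↦ absurd h hi.asymm, fun h ↦ absurd h hi.ne', fun _ ↦ hk⟩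
  choose c hneg hnull hpos using hc
  -- `m` extends the entries of `M` on the pattern to a total function with unit values.
  let m : ρ → κ → Aˣ := fun i k ↦ if hE : E i k then (hunit i k hE).unit else 1
  have hm : ∀ i k, E i k → (m i k : A) = M i k := fun i k hE ↦ by simp [m, hE]
  -- The left kernel of the tree columns, normalised to be `1` at the root `a₀`.
  let z : ρ → Aˣ := fun b ↦ - (m a₀ (c b) * (m b (c b))⁻¹)
  let w : ρ → Aˣ := fun i ↦ if i = a₀ then 1 else if l i < 0 then z i else
    - (z b₀ * m b₀ (c i) * (m i (c i))⁻¹)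
  let y : ρ → A := fun i ↦ if l i = 0 then 0 else w i
  have hy₀ : y a₀ = 1 := by simp [y, w, ha₀.ne']
  have hyb : ∀ b, l b < 0 → y b = z b := by
    intro b hb
    have : b ≠ a₀ := by rintro rfl; exact lt_asymm ha₀ hb
    simp [y, w, hb.ne, hb, this]
  have hy : ∀ i, i ≠ a₀ → ∑ i', y i' * M i' (c i) = 0 := by
    intro i hia
    rcases lt_trichotomy (l i) 0 with hi | hi | hi
    · rw [sum_mul_of_support_pair _ _ hia.symm fun i' hi' ↦
        hzero _ _ (by simp [hneg i hi, hi'.1, hi'.2]), hy₀, hyb i hi,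
        ← hm _ _ ((hneg i hi a₀).2 (Or.inl rfl)), ← hm _ _ ((hneg i hi i).2 (Or.inr rfl))]
      simp [z, mul_assoc]
    · rw [sum_mul_of_support_singleton _ _ i fun i' hi' ↦ hzero _ _ (by simp [hnull i hi, hi'])]
      simp [y, hi]
    · have hib : i ≠ b₀ := by rintro rfl; exact lt_asymm hb₀ hi
      rw [sum_mul_of_support_pair _ _ hib fun i' hi' ↦
        hzero _ _ (by simp [hpos i hi, hi'.1, hi'.2]), hyb b₀ hb₀,
        ← hm _ _ ((hpos i hi i).2 (Or.inl rfl)), ← hm _ _ ((hpos i hi b₀).2 (Or.inr rfl))]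
      simp [y, w, hi.ne', hia, hi.asymm, mul_assoc]
  have key := sum_mul_eq_zero_of_tree hunit hzero hdet ha₀ hb₀ c hneg hnull (fun a _ ↦ hpos a) y
    (by rw [hy₀]; exact isUnit_one) hy
  have hyw : ∀ i, l i ≠ 0 → y i = w i := fun i hi ↦ by simp [y, hi]
  let t : ρ → Aˣ := fun i ↦ if 0 < l i then (w i)⁻¹ else if l i < 0 then - (w i)⁻¹ else 1
  have hs : ∀ k, ∃ s : Aˣ, ∀ i, E i k → M i k = t i * s := by
    intro k
    rcases h.column k with ⟨i, hi, hE⟩ | ⟨a, b, ha, hb, hE⟩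
    · refine ⟨m i k, fun i' hi' ↦ ?_⟩
      obtain rfl := (hE i').1 hi'
      simp [t, hi, hm _ _ hi']
    · have hab : a ≠ b := by rintro rfl; exact lt_asymm ha hb
      have hk := key k
      rw [sum_mul_of_support_pair _ _ hab fun i' hi' ↦
        hzero _ _ (by simp [hE, hi'.1, hi'.2]), hyw a ha.ne', hyw b hb.ne] at hk
      refine ⟨w a * m a k, fun i' hi' ↦ ?_⟩
      have hma := hm a k ((hE a).2 (Or.inl rfl))
      rcases (hE i').1 hi' with rfl | rfl
      · simp [t, ha, hma]
      · simp only [t, hb.asymm, hb, if_true, if_false, Units.val_neg, Units.val_mul, hma]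
        rw [eq_neg_of_add_eq_zero_left hk]
        simp
  choose s hs using hs
  exact ⟨t, s, fun i k ↦ hs k i⟩

end IsCircuitPattern

/-! ### Nonnegative cocircuits of a hyperplane -/

/-- The image of an injective linear map into `ℝ^ρ` of codimension one is the orthogonal complement
of a nonzero vector. -/
theorem exists_range_eq_dotProduct_eq_zero {ρ E : Type*} [Fintype ρ] [AddCommGroup E] [Module ℝ E]
    [FiniteDimensional ℝ E] (G : E →ₗ[ℝ] (ρ → ℝ)) (hG : Function.Injective G)
    (hcard : Module.finrank ℝ E + 1 = Fintype.card ρ) :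
    ∃ l : ρ → ℝ, l ≠ 0 ∧ ∀ y, y ∈ LinearMap.range G ↔ ∑ i, l i * y i = 0 := by
  classical
  have hr : Module.finrank ℝ (LinearMap.range G) = Module.finrank ℝ E :=
    LinearMap.finrank_range_of_inj hG
  have hlt : LinearMap.range G < ⊤ := by
    refine lt_top_iff_ne_top.2 fun h ↦ ?_
    rw [h, finrank_top, Module.finrank_fintype_fun_eq_card] at hr
    omega
  obtain ⟨f, hf0, hf⟩ := Submodule.exists_le_ker_of_lt_top _ hlt
  have hker := Module.Dual.finrank_ker_add_one_of_ne_zero hf0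
  rw [Module.finrank_fintype_fun_eq_card] at hker
  have heq : LinearMap.range G = LinearMap.ker f :=
    Submodule.eq_of_le_of_finrank_eq hf (by omega)
  have hfy : ∀ y, f y = ∑ i, f (fun j ↦ if i = j then 1 else 0) * y i := fun y ↦ by
    rw [LinearMap.pi_apply_eq_sum_univ f y]
    simp [mul_comm]
  refine ⟨fun i ↦ f fun j ↦ if i = j then 1 else 0, fun h0 ↦ hf0 ?_, fun y ↦ ?_⟩
  · refine LinearMap.ext fun y ↦ ?_
    rw [hfy]
    exact Finset.sum_eq_zero fun i _ ↦ by rw [congrFun h0 i, Pi.zero_apply, zero_mul]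
  · rw [heq, LinearMap.mem_ker, hfy]

section

variable {ρ κ : Type*} [Fintype ρ]

/-- `y` spans an extreme ray of the cone of nonnegative vectors of the subspace `L`: every vector of `L`
supported on the support of `y` is a multiple of `y`. -/
structure IsCocircuit (L : Set (ρ → ℝ)) (y : ρ → ℝ) : Prop where
  mem : y ∈ L
  nonneg : ∀ i, 0 ≤ y i
  ne_zero : y ≠ 0
  eq_smul : ∀ y' ∈ L, (∀ i, y i = 0 → y' i = 0) → ∃ r : ℝ, y' = r • y

/-- If the columns of a matrix represent, up to equality of supports, all the nonnegative cocircuits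
of the hyperplane orthogonal to `l`, then its supports form a circuit pattern. -/
theorem isCircuitPattern_of_isCocircuit [DecidableEq ρ] {l : ρ → ℝ} (hl : l ≠ 0) {L : Set (ρ → ℝ)}
    (hL : ∀ y, y ∈ L ↔ ∑ i, l i * y i = 0) (hpos : ∃ y ∈ L, ∀ i, 0 < y i)
    (S : ρ → κ → ℝ) (hS : ∀ k, IsCocircuit L fun i ↦ S i k)
    (hex : ∀ y, IsCocircuit L y → ∃ k, ∀ i, S i k = 0 ↔ y i = 0) :
    IsCircuitPattern (fun i k ↦ S i k ≠ 0) l := by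
  have hpair : ∀ a b, 0 < l a → l b < 0 →
      (Pi.single a (-l b) + Pi.single b (l a) : ρ → ℝ) ∈ L := by
    intro a b ha hb
    rw [hL]
    simp [Pi.single_apply, mul_add, Finset.sum_add_distrib]
    ring
  have hsingle : ∀ i, l i = 0 → (Pi.single i 1 : ρ → ℝ) ∈ L := by
    intro i hi
    rw [hL]
    simp [Pi.single_apply, hi]
  -- A nonnegative vector orthogonal to `l` that meets the support of `l` meets both signs of `l`.
  have hsign : ∀ y : ρ → ℝ, (∀ i, 0 ≤ y i) → ∑ i, l i * y i = 0 → (∃ i, l i * y i ≠ 0) →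
      (∃ a, 0 < l a ∧ 0 < y a) ∧ ∃ b, l b < 0 ∧ 0 < y b := by
    rintro y hy hsum ⟨i, hi⟩
    constructor
    · obtain ⟨a, -, ha⟩ := Finset.exists_pos_of_sum_zero_of_exists_nonzero _ hsum
        ⟨i, Finset.mem_univ i, hi⟩
      have hya : 0 < y a := (hy a).lt_of_ne' fun h ↦ by simp [h] at ha
      exact ⟨a, pos_of_mul_pos_left ha hya.le, hya⟩
    · have hsum' : ∑ i, -(l i * y i) = 0 := by rw [Finset.sum_neg_distrib, hsum, neg_zero]
      obtain ⟨b, -, hb⟩ := Finset.exists_pos_of_sum_zero_of_exists_nonzero _ hsum'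
        ⟨i, Finset.mem_univ i, neg_ne_zero.2 hi⟩
      have hyb : 0 < y b := (hy b).lt_of_ne' fun h ↦ by simp [h] at hb
      exact ⟨b, neg_of_mul_neg_left (neg_pos.1 hb) hyb.le, hyb⟩
  obtain ⟨y₀, hy₀L, hy₀⟩ := hpos
  obtain ⟨i₀, hi₀⟩ := Function.ne_iff.1 hl
  obtain ⟨⟨a₀, ha₀, -⟩, b₀, hb₀, -⟩ := hsign y₀ (fun i ↦ (hy₀ i).le) ((hL _).1 hy₀L)
    ⟨i₀, mul_ne_zero hi₀ (hy₀ i₀).ne'⟩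
  -- A nonzero vector of `L` supported in the support of a column has the same support.
  have hsupp : ∀ k, ∀ y ∈ L, y ≠ 0 → (∀ i, S i k = 0 → y i = 0) → ∀ i, S i k ≠ 0 ↔ y i ≠ 0 := by
    intro k y hy hy0 hsub i
    obtain ⟨r, rfl⟩ := (hS k).eq_smul y hy hsub
    have hr : r ≠ 0 := by rintro rfl; exact hy0 (zero_smul _ _)
    simp [hr]
  refine ⟨⟨a₀, ha₀⟩, ⟨b₀, hb₀⟩, fun k ↦ ?_, fun i hi ↦ ?_, fun a b ha hb ↦ ?_⟩
  · by_cases hk : ∃ i, l i = 0 ∧ S i k ≠ 0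
    · obtain ⟨i, hi, hik⟩ := hk
      refine Or.inl ⟨i, hi, fun i' ↦ ?_⟩
      rw [hsupp k _ (hsingle i hi) (by simp) fun i' hi' ↦ ?_]
      · simp [Pi.single_apply]
      · have : i' ≠ i := by rintro rfl; exact hik hi'
        simp [this]
    · push Not at hk
      obtain ⟨i, hi⟩ := Function.ne_iff.1 (hS k).ne_zero
      obtain ⟨⟨a, ha, hak⟩, b, hb, hbk⟩ := hsign _ (hS k).nonneg ((hL _).1 (hS k).mem)
        ⟨i, mul_ne_zero (fun h ↦ hi (hk i h)) hi⟩
      have hab : a ≠ b := by rintro rfl; exact lt_asymm ha hb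
      refine Or.inr ⟨a, b, ha, hb, fun i' ↦ ?_⟩
      rw [hsupp k _ (hpair a b ha hb) (fun h ↦ ?_) fun i' hi' ↦ ?_]
      · by_cases h1 : i' = a
        · subst h1; simp [hab, hb.ne]
        · by_cases h2 : i' = b
          · subst h2; simp [h1, ha.ne']
          · simp [h1, h2]
      · have := congrFun h b
        simp [hab.symm, ha.ne'] at this
      · have h1 : i' ≠ a := by rintro rfl; exact hak.ne' hi'
        have h2 : i' ≠ b := by rintro rfl; exact hbk.ne' hi'
        simp [h1, h2]
  · have hco : IsCocircuit L (Pi.single i 1) := by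
      refine ⟨hsingle i hi, fun j ↦ ?_, by simp, fun y' _ hy' ↦ ⟨y' i, ?_⟩⟩
      · by_cases hj : j = i <;> simp [hj]
      · funext j
        by_cases hj : j = i
        · subst hj; simp
        · simp [hj, hy' j (by simp [hj])]
    obtain ⟨k, hk⟩ := hex _ hco
    exact ⟨k, fun i' ↦ by rw [Ne, hk]; simp [Pi.single_apply]⟩
  · have hab : a ≠ b := by rintro rfl; exact lt_asymm ha hb
    have hco : IsCocircuit L (Pi.single a (-l b) + Pi.single b (l a)) := by
      refine ⟨hpair a b ha hb, fun j ↦ ?_, fun h ↦ ?_, fun y' hyL hy' ↦ ⟨y' b / l a, ?_⟩⟩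
      · by_cases h1 : j = a
        · subst h1; simp [hab, hb.le]
        · by_cases h2 : j = b
          · subst h2; simp [h1, ha.le]
          · simp [h1, h2]
      · have := congrFun h b
        simp [hab.symm, ha.ne'] at this
      · have h0 : ∀ j, j ≠ a ∧ j ≠ b → y' j = 0 := fun j hj ↦ hy' j (by simp [hj.1, hj.2])
        have hsum := (hL _).1 hyL
        rw [sum_mul_of_support_pair _ _ hab h0] at hsum
        funext j
        by_cases h1 : j = a
        · subst h1
          simp [hab]
          field_simp
          linarith
        · by_cases h2 : j = b
          · subst h2; simp [h1, ha.ne']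
          · simp [h1, h2, h0 j ⟨h1, h2⟩]
    obtain ⟨k, hk⟩ := hex _ hco
    refine ⟨k, fun i' ↦ ?_⟩
    rw [Ne, hk]
    by_cases h1 : i' = a
    · subst h1; simp [hab, hb.ne]
    · by_cases h2 : i' = b
      · subst h2; simp [h1, ha.ne']
      · simp [h1, h2]

end

/-! ### Slack ideals and toric ideals of non-incidence graphs -/

theorem det_submatrix_id_eq_zero {R : Type*} [CommRing R] {m n : ℕ} (M : Matrix (Fin m) (Fin n) R)
    (h : ∀ c : Fin m ↪o Fin n, (M.submatrix id c).det = 0) (c : Fin m → Fin n) :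
    (M.submatrix id c).det = 0 := by
  by_cases hc : Function.Injective c
  · have hmono : StrictMono (c ∘ Tuple.sort c) :=
      (Tuple.monotone_sort c).strictMono_of_injective (hc.comp (Tuple.sort c).injective)
    have h1 := h (OrderEmbedding.ofStrictMono _ hmono)
    have h2 := det_permute' (Tuple.sort c) (M.submatrix id c)
    rw [submatrix_submatrix] at h2
    replace h2 := h2.symm.trans h1
    exact (((Equiv.Perm.sign (Tuple.sort c)).isUnit.map (Int.castRingHom R)).mul_right_eq_zero).1 h2
  · obtain ⟨i, j, hij, hne⟩ := Function.not_injective_iff.1 hc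
    exact det_zero_of_column_eq hne fun k ↦ by simp [hij]

/-- An order embedding of `Fin n` into itself is the identity, so the `n`-minors of an `n`-rowed
matrix involve all of its rows. -/
theorem orderEmbedding_fin_eq_id {n : ℕ} (r : Fin n ↪o Fin n) : (r : Fin n → Fin n) = id := by
  have h := Subsingleton.elim
    (r.strictMono.orderIsoOfSurjective r (Finite.surjective_of_injective r.injective))
    (OrderIso.refl (Fin n))
  exact funext fun i ↦ DFunLike.congr_fun h i

namespace LabelledPolytope

variable {d v f : ℕ} (P : LabelledPolytope d v f)

theorem incidenceMatrix_column (e : P.Var) :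
    (fun a ↦ P.incidenceMatrix a e) = Pi.single (Sum.inl e.1.1) 1 + Pi.single (Sum.inr e.1.2) 1 := by
  classical
  have hadj : P.nonIncidenceGraph.Adj (Sum.inl e.1.1) (Sum.inr e.1.2) := (P.varEquivEdge e).2
  have he : (P.varEquivEdge e : Sym2 (Fin v ⊕ Fin f)) = s(Sum.inl e.1.1, Sum.inr e.1.2) := rfl
  funext a
  simp only [incidenceMatrix, Matrix.of_apply, SimpleGraph.incMatrix_apply',
    SimpleGraph.incidenceSet, Set.mem_sep_iff, he]
  rcases a with i | j <;>
    simp [hadj, Pi.single_apply]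

/-- The variables as products `t_i s_j` of Laurent monomials, one for each row and each column. -/
theorem mem_graphToricIdeal (p : MvPolynomial P.Var ℂ) :
    p ∈ P.graphToricIdeal ↔
      MvPolynomial.aeval (R := ℂ) (fun e : P.Var ↦
        (AddMonoidAlgebra.single (Pi.single (Sum.inl e.1.1) 1) 1 *
          AddMonoidAlgebra.single (Pi.single (Sum.inr e.1.2) 1) 1 :
            AddMonoidAlgebra ℂ (Fin v ⊕ Fin f → ℤ))) p = 0 := by
  simp only [graphToricIdeal, toricIdeal, RingHom.mem_ker, incidenceMatrix_column,
    AddMonoidAlgebra.single_mul_single, mul_one]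

/-- A polynomial vanishing on the universal rank-one scaling vanishes on any other one, since a
homomorphism from the Laurent polynomial ring may send the variables to arbitrary units. -/
theorem aeval_eq_zero_of_mem_graphToricIdeal {A : Type*} [CommRing A] [Algebra ℂ A]
    (t : Fin v → Aˣ) (s : Fin f → Aˣ) {p : MvPolynomial P.Var ℂ} (hp : p ∈ P.graphToricIdeal) :
    MvPolynomial.aeval (fun e : P.Var ↦ (t e.1.1 * s e.1.2 : A)) p = 0 := by
  classical
  let u : Fin v ⊕ Fin f → Aˣ := Sum.elim t s
  let F : Multiplicative (Fin v ⊕ Fin f → ℤ) →* A :=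
    { toFun n := ((∏ a, u a ^ (n.toAdd a) : Aˣ) : A)
      map_one' := by simp
      map_mul' m n := by
        rw [← Units.val_mul, ← Finset.prod_mul_distrib]
        simp only [toAdd_mul, Pi.add_apply, _root_.zpow_add] }
  have hF : ∀ a, F (Multiplicative.ofAdd (Pi.single a 1)) = u a := by
    intro a
    simp only [F, MonoidHom.coe_mk, OneHom.coe_mk, toAdd_ofAdd]
    rw [Fintype.prod_eq_single a fun b hb ↦ by simp [hb]]
    simp
  have h := congrArg (AddMonoidAlgebra.lift ℂ A (Fin v ⊕ Fin f → ℤ) F)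
    ((P.mem_graphToricIdeal p).1 hp)
  rw [map_zero, ← AlgHom.comp_apply, MvPolynomial.comp_aeval] at h
  simpa [AddMonoidAlgebra.lift_single, hF, u] using h

/-- If every matrix with the support of the slack matrix and vanishing `(d + 2)`-minors over every
commutative ring is a rank-one scaling of the support, then the toric ideal of the non-incidence
graph lies in the slack ideal. The criterion is applied to the symbolic slack matrix over the
coordinate ring of the slack ideal with the variables inverted. -/
theorem graphToricIdeal_le_slackIdeal
    (H : ∀ (A : Type) [CommRing A] (M : Matrix (Fin v) (Fin f) A),
      (∀ i j, P.slackMatrix i j ≠ 0 → IsUnit (M i j)) →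
      (∀ i j, ¬ P.slackMatrix i j ≠ 0 → M i j = 0) →
      (∀ (r : Fin (d + 2) ↪o Fin v) (c : Fin (d + 2) ↪o Fin f), (M.submatrix r c).det = 0) →
      ∃ (t : Fin v → Aˣ) (s : Fin f → Aˣ), ∀ i j, P.slackMatrix i j ≠ 0 → M i j = t i * s j) :
    P.graphToricIdeal ≤ P.slackIdeal := by
  classical
  intro p hp
  let J := minorIdeal (d + 2) P.symbolicSlackMatrix
  let g : MvPolynomial P.Var ℂ := ∏ x : P.Var, MvPolynomial.X x
  let Q := MvPolynomial P.Var ℂ ⧸ J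
  let A := Localization.Away (Ideal.Quotient.mk J g)
  let φ : MvPolynomial P.Var ℂ →ₐ[ℂ] A :=
    (Algebra.ofId Q A |>.restrictScalars ℂ).comp (Ideal.Quotient.mkₐ ℂ J)
  have hφ : ∀ q, φ q = algebraMap Q A (Ideal.Quotient.mk J q) := fun _ ↦ rfl
  have hX : ∀ x, IsUnit (φ (MvPolynomial.X x)) := by
    intro x
    have hg : IsUnit (φ g) := IsLocalization.Away.algebraMap_isUnit (S := A) (Ideal.Quotient.mk J g)
    exact isUnit_of_dvd_unit (map_dvd φ (Finset.dvd_prod_of_mem _ (Finset.mem_univ x))) hg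
  obtain ⟨t, s, hts⟩ := H A (P.symbolicSlackMatrix.map φ)
    (fun i j hij ↦ by simpa [symbolicSlackMatrix, hij] using hX ⟨(i, j), hij⟩)
    (fun i j hij ↦ by simp [symbolicSlackMatrix, not_not.1 hij])
    (fun r c ↦ by
      have hmem : (P.symbolicSlackMatrix.submatrix r c).det ∈ J := Ideal.subset_span ⟨r, c, rfl⟩
      rw [submatrix_map, ← AlgHom.mapMatrix_apply, ← AlgHom.map_det, hφ,
        Ideal.Quotient.eq_zero_iff_mem.2 hmem, map_zero])
  have hφX : φ = MvPolynomial.aeval fun e : P.Var ↦ (t e.1.1 * s e.1.2 : A) := by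
    refine MvPolynomial.algHom_ext fun e ↦ ?_
    rw [MvPolynomial.aeval_X, ← hts _ _ e.2]
    simp [symbolicSlackMatrix, e.2]
  have h0 : φ p = 0 := by
    rw [hφX]; exact P.aeval_eq_zero_of_mem_graphToricIdeal t s hp
  rw [hφ, IsLocalization.map_eq_zero_iff (Submonoid.powers (Ideal.Quotient.mk J g))] at h0
  obtain ⟨⟨_, k, rfl⟩, hk⟩ := h0
  refine ⟨k, Ideal.Quotient.eq_zero_iff_mem.1 ?_⟩
  rw [map_mul, map_pow]
  exact hk

/-- If the `(d + 2)`-minors of the `0/1` support matrix of the slack matrix vanish, then the slack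
ideal lies in the toric ideal of the non-incidence graph. -/
theorem slackIdeal_le_graphToricIdeal
    (H : ∀ (r : Fin (d + 2) ↪o Fin v) (c : Fin (d + 2) ↪o Fin f),
      (Matrix.of fun i j ↦ if P.slackMatrix (r i) (c j) ≠ 0 then (1 : ℤ) else 0).det = 0) :
    P.slackIdeal ≤ P.graphToricIdeal := by
  classical
  let B := AddMonoidAlgebra ℂ (Fin v ⊕ Fin f → ℤ)
  let m : Fin v ⊕ Fin f → B := fun a ↦ AddMonoidAlgebra.single (Pi.single a 1) 1
  have hm : ∀ a, IsUnit (m a) := fun a ↦ by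
    refine IsUnit.of_mul_eq_one (AddMonoidAlgebra.single (-Pi.single a 1) 1) ?_
    rw [AddMonoidAlgebra.single_mul_single, add_neg_cancel, mul_one]
    rfl
  let φ : MvPolynomial P.Var ℂ →ₐ[ℂ] B :=
    MvPolynomial.aeval fun e : P.Var ↦ m (Sum.inl e.1.1) * m (Sum.inr e.1.2)
  have hmem : ∀ p, p ∈ P.graphToricIdeal ↔ φ p = 0 := P.mem_graphToricIdeal
  have hJ : minorIdeal (d + 2) P.symbolicSlackMatrix ≤ P.graphToricIdeal := by
    refine Ideal.span_le.2 ?_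
    rintro _ ⟨r, c, rfl⟩
    rw [SetLike.mem_coe, hmem, AlgHom.map_det]
    let N : Matrix (Fin (d + 2)) (Fin (d + 2)) B :=
      (Matrix.of fun i j ↦ if P.slackMatrix (r i) (c j) ≠ 0 then (1 : ℤ) else 0).map
        (Int.castRingHom B)
    have hN : N.det = 0 := by
      rw [show N = (Int.castRingHom B).mapMatrix _ from rfl, ← RingHom.map_det, H r c, map_zero]
    have : φ.mapMatrix (P.symbolicSlackMatrix.submatrix r c) =
        Matrix.of fun i j ↦ m (Sum.inl (r i)) *
          (Matrix.of fun i j ↦ m (Sum.inr (c j)) * N i j) i j := by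
      ext1 i j
      by_cases hij : P.slackMatrix (r i) (c j) = 0
      · simp [symbolicSlackMatrix, hij, N]
      · simp [symbolicSlackMatrix, hij, N, φ]
    rw [this, det_mul_column, det_mul_row, hN, mul_zero, mul_zero]
  rintro p ⟨k, hk⟩
  have h0 := (hmem _).1 (hJ hk)
  rw [map_mul, map_pow, map_prod] at h0
  have hu : IsUnit ((∏ x : P.Var, φ (MvPolynomial.X x)) ^ k) := by
    refine IsUnit.pow _ ?_
    rw [IsUnit.prod_univ_iff]
    intro x
    simpa [φ] using (hm _).mul (hm _)
  exact (hmem p).2 (hu.mul_right_eq_zero.1 h0)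

end LabelledPolytope

theorem isToric_toricIdeal {ι σ : Type*} [Finite ι] (M : Matrix ι σ ℤ) :
    IsToric (toricIdeal M) := by
  obtain ⟨n, ⟨e⟩⟩ := Finite.exists_equiv_fin ι
  refine ⟨n, M.submatrix e.symm id, ?_⟩
  let g := AddMonoidAlgebra.domCongr ℂ ℂ (AddEquiv.arrowCongr e (AddEquiv.refl ℤ))
  ext p
  rw [toricIdeal, toricIdeal, RingHom.mem_ker, RingHom.mem_ker, ← map_eq_zero_iff g g.injective]
  change g.toAlgHom _ = 0 ↔ _
  rw [← AlgHom.comp_apply, MvPolynomial.comp_aeval]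
  simp only [g, AlgEquiv.coe_toAlgHom, AddMonoidAlgebra.domCongr_single]
  rfl

/-! ### Faces and facets of a polytope -/

namespace LabelledPolytope

variable {d v f : ℕ} (P : LabelledPolytope d v f)

theorem vertex_mem_carrier (i : Fin v) : P.vertex i ∈ P.carrier := by
  rw [P.carrier_eq]
  exact subset_convexHull ℝ _ ⟨i, rfl⟩

theorem convex_carrier : Convex ℝ P.carrier := by
  rw [P.carrier_eq]
  exact convex_convexHull ℝ (Set.range P.vertex)

theorem isCompact_carrier : IsCompact P.carrier := by
  rw [P.carrier_eq]
  exact (Set.finite_range _).isCompact_convexHull ℝ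

theorem interior_carrier_nonempty : (interior P.carrier).Nonempty := by
  have h := P.affineSpan_carrier
  rw [P.carrier_eq, affineSpan_convexHull] at h
  rw [P.carrier_eq]
  exact interior_convexHull_nonempty_iff_affineSpan_eq_top.2 h

theorem carrier_subset_of_vertex_mem {s : Set (EuclideanSpace ℝ (Fin d))} (hs : Convex ℝ s)
    (h : ∀ i, P.vertex i ∈ s) : P.carrier ⊆ s := by
  rw [P.carrier_eq]
  exact convexHull_min (Set.range_subset_iff.2 h) hs

/-- A face is the convex hull of the vertices it contains. -/
theorem mem_convexHull_of_mem_face (φ : EuclideanSpace ℝ (Fin d) →ₗ[ℝ] ℝ) {c : ℝ}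
    (hφ : ∀ i, φ (P.vertex i) ≤ c) {x : EuclideanSpace ℝ (Fin d)} (hx : x ∈ P.carrier)
    (hxc : φ x = c) : x ∈ convexHull ℝ (P.vertex '' {i | φ (P.vertex i) = c}) := by
  classical
  rw [P.carrier_eq, mem_convexHull_iff_exists_fintype] at hx
  obtain ⟨ι, _, w, z, hw, hw1, hz, rfl⟩ := hx
  have hzc : ∀ k, φ (z k) ≤ c := fun k ↦ by
    obtain ⟨i, hi⟩ := hz k
    rw [← hi]; exact hφ i
  have hsum : ∑ k, w k * (c - φ (z k)) = 0 := by
    simp only [mul_sub, Finset.sum_sub_distrib, ← Finset.sum_mul, hw1, one_mul]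
    rw [← hxc]
    simp
  have hzero := (Finset.sum_eq_zero_iff_of_nonneg fun k _ ↦
    mul_nonneg (hw k) (sub_nonneg.2 (hzc k))).1 hsum
  have h1 : ∑ k ∈ Finset.univ.filter fun k ↦ w k ≠ 0, w k = 1 := by
    rw [Finset.sum_filter_ne_zero, hw1]
  have h2 : ∑ k ∈ Finset.univ.filter fun k ↦ w k ≠ 0, w k • z k = ∑ k, w k • z k :=
    Finset.sum_filter_of_ne fun k _ hk h0 ↦ hk (by rw [h0, zero_smul])
  rw [← h2]
  refine (convex_convexHull ℝ _).sum_mem (fun k _ ↦ hw k) h1 fun k hk ↦ subset_convexHull ℝ _ ?_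
  obtain ⟨i, hi⟩ := hz k
  refine ⟨i, ?_, hi⟩
  have := (mul_eq_zero.1 (hzero k (Finset.mem_univ k))).resolve_left (Finset.mem_filter.1 hk).2
  rw [Set.mem_ofPred_eq, hi]
  linarith

theorem isFacet_facet (j : Fin f) : IsFacet P.carrier (P.facet j) := by
  have : P.facet j ∈ {F | IsFacet P.carrier F} := P.range_facet ▸ ⟨j, rfl⟩
  exact this

theorem exists_facet_eq {F : Set (EuclideanSpace ℝ (Fin d))} (hF : IsFacet P.carrier F) :
    ∃ j, P.facet j = F := by
  have : F ∈ {F | IsFacet P.carrier F} := hF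
  rw [← P.range_facet] at this
  exact this

theorem vectorSpan_le_orthogonal {s : Set (EuclideanSpace ℝ (Fin d))}
    {W : EuclideanSpace ℝ (Fin d)} {w : ℝ} (h : ∀ x ∈ s, inner ℝ W x = w) :
    vectorSpan ℝ s ≤ (ℝ ∙ W)ᗮ := by
  rw [vectorSpan_def, Submodule.span_le]
  rintro _ ⟨x, hx, y, hy, rfl⟩
  rw [SetLike.mem_coe, Submodule.mem_orthogonal_singleton_iff_inner_right]
  change inner ℝ W (x - y) = 0
  rw [inner_sub_right, h x hx, h y hy, sub_self]

/-- A polytope is the intersection of its facet half-spaces. Given a point `x` outside, the segment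
from `x` to an interior point `y` leaves the polytope through a face; for `y` off the finitely many
proper flats spanned by `x` and sets of vertices, that face is a facet. -/
theorem exists_offset_lt_inner {x : EuclideanSpace ℝ (Fin d)} (hx : x ∉ P.carrier) :
    ∃ j, P.offset j < inner ℝ (P.normal j) x := by
  obtain ⟨y, hy, hyT⟩ : ∃ y ∈ interior P.carrier, ∀ T : Set (Fin v),
      affineSpan ℝ (insert x (P.vertex '' T)) ≠ ⊤ →
        y ∉ affineSpan ℝ (insert x (P.vertex '' T)) := by
    by_contra! hcon
    have hnull : MeasureTheory.volume (⋃ T : {T : Set (Fin v) //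
        affineSpan ℝ (insert x (P.vertex '' T)) ≠ ⊤},
        (affineSpan ℝ (insert x (P.vertex '' T.1)) : Set (EuclideanSpace ℝ (Fin d)))) = 0 :=
      MeasureTheory.measure_iUnion_null fun T ↦
        MeasureTheory.Measure.addHaar_affineSubspace _ _ T.2
    have hpos := isOpen_interior.measure_pos MeasureTheory.volume P.interior_carrier_nonempty
    refine hpos.ne' (MeasureTheory.measure_mono_null (fun y hy ↦ ?_) hnull)
    obtain ⟨T, hT, hyT⟩ := hcon y hy
    exact Set.mem_iUnion.2 ⟨⟨T, hT⟩, hyT⟩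
  obtain ⟨z, hz, hzy, hvis⟩ := P.isCompact_carrier.isClosed.exists_wbtw_isVisible
    (interior_subset hy) x
  have hxz : x ≠ z := by rintro rfl; exact hx hz
  have hzint : z ∉ interior P.carrier := by
    intro hzi
    have h1 : ∀ᶠ r : ℝ in nhdsWithin 0 (Set.Ioi 0), AffineMap.lineMap z x r ∈ P.carrier := by
      have hcont : Filter.Tendsto (fun r : ℝ ↦ AffineMap.lineMap z x r) (nhds 0) (nhds z) := by
        have := (AffineMap.lineMap_continuous (R := ℝ) (p := z) (q := x)).tendsto 0
        simpa using this
      exact (hcont.mono_left nhdsWithin_le_nhds).eventually (mem_interior_iff_mem_nhds.1 hzi)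
    obtain ⟨r, hr, hr01⟩ := (h1.and (Ioo_mem_nhdsGT one_pos)).exists
    exact hvis hr (sbtw_comm.1 (sbtw_lineMap_iff.2 ⟨hxz.symm, hr01⟩))
  obtain ⟨φ, hφ⟩ := geometric_hahn_banach_open_point P.convex_carrier.interior isOpen_interior hzint
  have hφle : ∀ p ∈ P.carrier, φ p ≤ φ z := by
    intro p hp
    have hcl : p ∈ closure (interior P.carrier) := by
      rw [P.convex_carrier.closure_interior_eq_closure_of_nonempty_interior
        P.interior_carrier_nonempty]
      exact subset_closure hp
    exact closure_minimal (fun q hq ↦ (hφ q hq).le) (isClosed_le φ.continuous continuous_const) hcl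
  let F := {p | p ∈ P.carrier ∧ φ p = φ z}
  let T := {i | φ (P.vertex i) = φ z}
  have hTF : P.vertex '' T ⊆ F := by
    rintro _ ⟨i, hi, rfl⟩
    exact ⟨P.vertex_mem_carrier i, hi⟩
  have htop : affineSpan ℝ (insert x (P.vertex '' T)) = ⊤ := by
    by_contra hne
    refine hyT T hne ?_
    have hzT : z ∈ affineSpan ℝ (insert x (P.vertex '' T)) :=
      affineSpan_mono ℝ (Set.subset_insert _ _) (convexHull_subset_affineSpan _
        (P.mem_convexHull_of_mem_face φ.toLinearMap
          (fun i ↦ hφle _ (P.vertex_mem_carrier i)) hz rfl))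
    exact affineSpan_pair_le_of_mem_of_mem (mem_affineSpan ℝ (Set.mem_insert _ _)) hzT
      (hzy.right_mem_affineSpan_of_left_ne hxz)
  have hge : d ≤ Module.finrank ℝ (vectorSpan ℝ F) + 1 := by
    have h1 := finrank_vectorSpan_insert_le_set ℝ (P.vertex '' T) x
    rw [AffineSubspace.vectorSpan_eq_top_of_affineSpan_eq_top ℝ _ _ htop, finrank_top,
      finrank_euclideanSpace_fin] at h1
    have h2 := Submodule.finrank_mono (vectorSpan_mono ℝ hTF)
    omega
  have hle : Module.finrank ℝ (vectorSpan ℝ F) + 1 ≤ d := by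
    have hφ0 : φ.toLinearMap ≠ 0 := by
      intro h0
      have h1 : ∀ q, φ q = 0 := fun q ↦ LinearMap.congr_fun h0 q
      have := hφ y hy
      rw [h1, h1] at this
      exact lt_irrefl _ this
    have h1 := Module.Dual.finrank_ker_add_one_of_ne_zero hφ0
    have h2 : vectorSpan ℝ F ≤ LinearMap.ker φ.toLinearMap := by
      rw [vectorSpan_def, Submodule.span_le]
      rintro _ ⟨p, hp, q, hq, rfl⟩
      simp [hp.2, hq.2]
    rw [finrank_euclideanSpace_fin] at h1
    have h3 := Submodule.finrank_mono h2
    omega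
  have hFfacet : IsFacet P.carrier F := by
    refine ⟨fun _ ↦ ⟨φ, ?_⟩, ⟨z, hz, rfl⟩, le_antisymm hle hge⟩
    ext p
    constructor
    · rintro ⟨hp, hpz⟩
      exact ⟨hp, fun q hq ↦ hpz ▸ hφle q hq⟩
    · rintro ⟨hp, hmax⟩
      exact ⟨hp, le_antisymm (hφle p hp) (hmax z hz)⟩
  obtain ⟨j, hj⟩ := P.exists_facet_eq hFfacet
  have hzj : inner ℝ (P.normal j) z = P.offset j := by
    have : z ∈ P.facet j := hj ▸ ⟨hz, rfl⟩
    exact this.2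
  have hyj : inner ℝ (P.normal j) y < P.offset j := by
    refine lt_of_le_of_ne (P.inner_le_offset j y (interior_subset hy)) fun h ↦ ?_
    have : y ∈ F := hj ▸ (⟨interior_subset hy, h⟩ : y ∈ P.facet j)
    exact (hφ y hy).ne this.2
  refine ⟨j, ?_⟩
  obtain ⟨r, ⟨hr0, hr1⟩, hr⟩ := hzy
  rw [AffineMap.lineMap_apply_module] at hr
  have hr0' : 0 < r := by
    refine lt_of_le_of_ne hr0 fun h ↦ hxz ?_
    rw [← hr, ← h]; simp
  rw [← hr, inner_add_right, inner_smul_right, inner_smul_right] at hzj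
  by_contra! hcon
  nlinarith [mul_lt_mul_of_pos_left hyj hr0', mul_le_mul_of_nonneg_left hcon (sub_nonneg.2 hr1)]

theorem mem_carrier_iff {x : EuclideanSpace ℝ (Fin d)} :
    x ∈ P.carrier ↔ ∀ j, inner ℝ (P.normal j) x ≤ P.offset j := by
  refine ⟨fun hx j ↦ P.inner_le_offset j x hx, fun h ↦ ?_⟩
  by_contra hx
  obtain ⟨j, hj⟩ := P.exists_offset_lt_inner hx
  exact (h j).not_gt hj

theorem slackMatrix_apply (i : Fin v) (j : Fin f) :
    P.slackMatrix i j = P.offset j - inner ℝ (P.normal j) (P.vertex i) := rfl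

theorem slackMatrix_nonneg (i : Fin v) (j : Fin f) : 0 ≤ P.slackMatrix i j :=
  sub_nonneg.2 (P.inner_le_offset j _ (P.vertex_mem_carrier i))

theorem exists_slackMatrix_pos (j : Fin f) : ∃ i, 0 < P.slackMatrix i j := by
  by_contra! hcon
  have h0 : ∀ i, inner ℝ (P.normal j) (P.vertex i) = P.offset j := fun i ↦ by
    have := le_antisymm (hcon i) (P.slackMatrix_nonneg i j)
    rw [slackMatrix_apply] at this
    linarith
  have hsub : P.carrier ⊆ P.facet j := fun x hx ↦ ⟨hx,
    P.carrier_subset_of_vertex_mem (convex_hyperplane (innerₗ _ (P.normal j)).isLinear _) h0 hx⟩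
  have h1 : vectorSpan ℝ (P.facet j) = ⊤ := top_unique <| by
    rw [← AffineSubspace.vectorSpan_eq_top_of_affineSpan_eq_top ℝ _ _ P.affineSpan_carrier]
    exact vectorSpan_mono ℝ hsub
  have h2 := (P.isFacet_facet j).2.2
  rw [h1, finrank_top, finrank_euclideanSpace_fin] at h2
  omega

theorem normal_ne_zero (j : Fin f) : P.normal j ≠ 0 := by
  intro h0
  obtain ⟨i, hi⟩ := P.exists_slackMatrix_pos j
  obtain ⟨x, hx⟩ := (P.isFacet_facet j).2.1
  have := hx.2
  rw [slackMatrix_apply] at hi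
  rw [h0, inner_zero_left] at this hi
  linarith

/-! ### Slack vectors of affine functions -/

/-- The affine function `x ↦ w - ⟨W, x⟩`, given as the pair `(W, w)`, evaluated at the vertices. -/
noncomputable def vertexSlack : (EuclideanSpace ℝ (Fin d) × ℝ) →ₗ[ℝ] (Fin v → ℝ) where
  toFun e i := e.2 - inner ℝ e.1 (P.vertex i)
  map_add' a b := by
    funext i
    simp only [Prod.fst_add, Prod.snd_add, inner_add_left, Pi.add_apply]
    ring
  map_smul' r a := by
    funext i
    simp only [Prod.smul_fst, Prod.smul_snd, inner_smul_left, Pi.smul_apply, smul_eq_mul,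
      RingHom.id_apply, conj_trivial]
    ring

theorem vertexSlack_apply (W : EuclideanSpace ℝ (Fin d)) (w : ℝ) (i : Fin v) :
    P.vertexSlack (W, w) i = w - inner ℝ W (P.vertex i) := rfl

theorem nonempty_vertex (P : LabelledPolytope d v f) : Nonempty (Fin v) := by
  obtain ⟨x, hx⟩ := P.interior_carrier_nonempty
  have := interior_subset hx
  rw [P.carrier_eq] at this
  obtain ⟨_, i, -⟩ := convexHull_nonempty_iff.1 ⟨x, this⟩
  exact ⟨i⟩

theorem vertexSlack_injective : Function.Injective P.vertexSlack := by
  rw [← LinearMap.ker_eq_bot, LinearMap.ker_eq_bot']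
  rintro ⟨W, w⟩ h
  have h0 : ∀ i, inner ℝ W (P.vertex i) = w := fun i ↦ by
    have := congrFun h i
    rw [vertexSlack_apply, Pi.zero_apply] at this
    linarith
  have h1 := vectorSpan_le_orthogonal (P.carrier_subset_of_vertex_mem
    (convex_hyperplane (innerₗ _ W).isLinear _) h0)
  rw [AffineSubspace.vectorSpan_eq_top_of_affineSpan_eq_top ℝ _ _ P.affineSpan_carrier] at h1
  have hW : W = 0 := by
    have := Submodule.mem_orthogonal_singleton_iff_inner_right.1 (h1 (Submodule.mem_top (x := W)))
    exact inner_self_eq_zero.1 this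
  obtain ⟨i⟩ := P.nonempty_vertex
  have := h0 i
  rw [hW, inner_zero_left] at this
  rw [hW, ← this]
  rfl

/-- Facets give cocircuits: an affine function vanishing on a facet is a multiple of the facet
inequality. -/
theorem isCocircuit_column (j : Fin f) :
    IsCocircuit (Set.range P.vertexSlack) fun i ↦ P.slackMatrix i j := by
  refine ⟨⟨(P.normal j, P.offset j), rfl⟩, fun i ↦ P.slackMatrix_nonneg i j, fun h ↦ ?_, ?_⟩
  · obtain ⟨i, hi⟩ := P.exists_slackMatrix_pos j
    exact hi.ne' (congrFun h i)
  · rintro _ ⟨⟨W, w⟩, rfl⟩ hvan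
    obtain ⟨-, ⟨x₀, hx₀⟩, hdim⟩ := P.isFacet_facet j
    have hF : ∀ x ∈ P.facet j, inner ℝ W x = w := by
      intro x hx
      have := P.mem_convexHull_of_mem_face (innerₗ _ (P.normal j))
        (fun i ↦ P.inner_le_offset j _ (P.vertex_mem_carrier i)) hx.1 hx.2
      refine convexHull_min ?_ (convex_hyperplane (innerₗ _ W).isLinear w) this
      rintro _ ⟨i, hi, rfl⟩
      have := hvan i (sub_eq_zero.2 (Eq.symm hi))
      rw [vertexSlack_apply] at this
      exact (sub_eq_zero.1 this).symm
    set K := vectorSpan ℝ (P.facet j)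
    have hK : ∀ {U : EuclideanSpace ℝ (Fin d)} {u : ℝ},
        (∀ x ∈ P.facet j, inner ℝ U x = u) → U ∈ Kᗮ :=
      fun h ↦ Submodule.le_orthogonal_iff_le_orthogonal.1 (vectorSpan_le_orthogonal h)
        (Submodule.mem_span_singleton_self _)
    have hdim' : Module.finrank ℝ Kᗮ = 1 := by
      have := Submodule.finrank_add_finrank_orthogonal K
      rw [finrank_euclideanSpace_fin] at this
      omega
    obtain ⟨r, hr⟩ := (finrank_eq_one_iff_of_nonzero' (⟨P.normal j, hK fun x hx ↦ hx.2⟩ : Kᗮ)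
      (fun h ↦ P.normal_ne_zero j (congrArg Subtype.val h))).1 hdim' ⟨W, hK hF⟩
    have hr' : r • P.normal j = W := congrArg Subtype.val hr
    have hw : w = r * P.offset j := by
      rw [← hF x₀ hx₀, ← hr', real_inner_smul_left, hx₀.2]
    refine ⟨r, funext fun i ↦ ?_⟩
    rw [vertexSlack_apply, ← hr', real_inner_smul_left, hw, Pi.smul_apply, smul_eq_mul,
      slackMatrix_apply]
    ring

/-- Cocircuits come from facets: the affine function vanishes on a face of the polytope, and only its
multiples vanish there, so that face has codimension one. -/
theorem exists_column_of_isCocircuit (hd : 0 < d) {y : Fin v → ℝ}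
    (hy : IsCocircuit (Set.range P.vertexSlack) y) :
    ∃ j, ∀ i, P.slackMatrix i j = 0 ↔ y i = 0 := by
  obtain ⟨⟨W, w⟩, rfl⟩ := hy.mem
  have hmul : ∀ U u, (∀ i, P.vertexSlack (W, w) i = 0 → P.vertexSlack (U, u) i = 0) →
      ∃ r : ℝ, r • W = U ∧ r * w = u := by
    intro U u h
    obtain ⟨r, hr⟩ := hy.eq_smul _ ⟨(U, u), rfl⟩ h
    rw [← map_smul] at hr
    have := P.vertexSlack_injective hr
    exact ⟨r, (congrArg Prod.fst this).symm, (congrArg Prod.snd this).symm⟩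
  have hle : ∀ x ∈ P.carrier, inner ℝ W x ≤ w :=
    P.carrier_subset_of_vertex_mem (convex_halfSpace_le (innerₗ _ W).isLinear w)
      fun i ↦ sub_nonneg.1 (hy.nonneg i)
  obtain ⟨i₀, hi₀⟩ : ∃ i, P.vertexSlack (W, w) i = 0 := by
    by_contra! hne
    have h1 : Module.finrank ℝ (EuclideanSpace ℝ (Fin d) × ℝ) ≤ 1 := by
      refine finrank_le_one (W, w) fun e ↦ ?_
      obtain ⟨r, h1, h2⟩ := hmul e.1 e.2 fun i hi ↦ absurd hi (hne i)
      exact ⟨r, Prod.ext h1 h2⟩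
    rw [Module.finrank_prod, finrank_euclideanSpace_fin, Module.finrank_self] at h1
    omega
  have hx₀ : inner ℝ W (P.vertex i₀) = w := (sub_eq_zero.1 hi₀).symm
  let F := {x | x ∈ P.carrier ∧ inner ℝ W x = w}
  set K := vectorSpan ℝ F with hKdef
  have hWK : W ∈ Kᗮ := Submodule.le_orthogonal_iff_le_orthogonal.1
    (vectorSpan_le_orthogonal fun x hx ↦ hx.2) (Submodule.mem_span_singleton_self _)
  have hW0 : W ≠ 0 := by
    rintro rfl
    rw [inner_zero_left] at hx₀
    subst hx₀
    exact hy.ne_zero (map_zero P.vertexSlack)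
  have hdim : Module.finrank ℝ Kᗮ = 1 := by
    refine (finrank_eq_one_iff_of_nonzero' (⟨W, hWK⟩ : Kᗮ)
      (fun h ↦ hW0 (congrArg Subtype.val h))).2 ?_
    rintro ⟨U, hU⟩
    obtain ⟨r, hr, -⟩ := hmul U (inner ℝ U (P.vertex i₀)) fun i hi ↦ by
      have hmem : P.vertex i - P.vertex i₀ ∈ K := vsub_mem_vectorSpan ℝ
        (⟨P.vertex_mem_carrier i, (sub_eq_zero.1 hi).symm⟩ : P.vertex i ∈ F)
        ⟨P.vertex_mem_carrier i₀, hx₀⟩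
      have := (Submodule.mem_orthogonal' K U).1 hU _ hmem
      rw [inner_sub_right] at this
      rw [vertexSlack_apply]
      linarith
    exact ⟨r, Subtype.ext hr⟩
  have hF : IsFacet P.carrier F := by
    refine ⟨fun _ ↦ ⟨innerSL ℝ W, ?_⟩, ⟨P.vertex i₀, P.vertex_mem_carrier i₀, hx₀⟩, ?_⟩
    · ext x
      constructor
      · rintro ⟨hx, hxw⟩
        exact ⟨hx, fun q hq ↦ by simpa [hxw] using hle q hq⟩
      · rintro ⟨hx, hmax⟩
        refine ⟨hx, le_antisymm (hle x hx) ?_⟩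
        simpa [hx₀] using hmax _ (P.vertex_mem_carrier i₀)
    · have := Submodule.finrank_add_finrank_orthogonal K
      rw [hdim, finrank_euclideanSpace_fin] at this
      exact this
  obtain ⟨j, hj⟩ := P.exists_facet_eq hF
  refine ⟨j, fun i ↦ ?_⟩
  have h1 := P.slackMatrix_ne_zero_iff i j
  rw [hj, not_iff_not] at h1
  rw [h1, vertexSlack_apply, sub_eq_zero, eq_comm]
  exact and_iff_right (P.vertex_mem_carrier i)

/-! ### Slack vectors of points -/

/-- The slacks `t w_j - ⟨W_j, x⟩` of the point with homogeneous coordinates `(x, t)`. -/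
noncomputable def facetSlack : (EuclideanSpace ℝ (Fin d) × ℝ) →ₗ[ℝ] (Fin f → ℝ) where
  toFun e j := e.2 * P.offset j - inner ℝ (P.normal j) e.1
  map_add' a b := by
    funext i
    simp only [Prod.fst_add, Prod.snd_add, inner_add_right, Pi.add_apply]
    ring
  map_smul' r a := by
    funext i
    simp only [Prod.smul_fst, Prod.smul_snd, inner_smul_right, Pi.smul_apply, smul_eq_mul,
      RingHom.id_apply]
    ring

theorem facetSlack_apply (x : EuclideanSpace ℝ (Fin d)) (t : ℝ) (j : Fin f) :
    P.facetSlack (x, t) j = t * P.offset j - inner ℝ (P.normal j) x := rfl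

theorem facetSlack_vertex (i : Fin v) : P.facetSlack (P.vertex i, 1) = P.slackMatrix i := by
  funext j
  rw [facetSlack_apply, one_mul, slackMatrix_apply]

/-- A polytope has no direction of recession. -/
theorem eq_zero_of_inner_nonpos {x : EuclideanSpace ℝ (Fin d)}
    (h : ∀ j, inner ℝ (P.normal j) x ≤ 0) : x = 0 := by
  obtain ⟨i⟩ := P.nonempty_vertex
  obtain ⟨C, hC⟩ := P.isCompact_carrier.isBounded.exists_norm_le
  by_contra hx
  have hx' : 0 < ‖x‖ := norm_pos_iff.2 hx
  set r := (C + ‖P.vertex i‖ + 1) / ‖x‖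
  have hC0 : 0 ≤ C := (norm_nonneg _).trans (hC _ (P.vertex_mem_carrier i))
  have hr : 0 ≤ r := by positivity
  have hmem : P.vertex i + r • x ∈ P.carrier := by
    rw [mem_carrier_iff]
    intro j
    rw [inner_add_right, inner_smul_right]
    have := P.inner_le_offset j _ (P.vertex_mem_carrier i)
    nlinarith [mul_nonneg hr (neg_nonneg.2 (h j))]
  have h1 := hC _ hmem
  have h2 : ‖r • x‖ = C + ‖P.vertex i‖ + 1 := by
    rw [norm_smul, Real.norm_of_nonneg hr, div_mul_cancel₀ _ hx'.ne']
  have h3 : ‖r • x‖ ≤ ‖P.vertex i + r • x‖ + ‖P.vertex i‖ := by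
    have := norm_sub_le (P.vertex i + r • x) (P.vertex i)
    rwa [add_sub_cancel_left] at this
  linarith

theorem facetSlack_injective [Nonempty (Fin f)] : Function.Injective P.facetSlack := by
  rw [← LinearMap.ker_eq_bot, LinearMap.ker_eq_bot']
  rintro ⟨x, t⟩ h
  have h0 : ∀ j, inner ℝ (P.normal j) x = t * P.offset j := fun j ↦ by
    have := congrFun h j
    rw [facetSlack_apply, Pi.zero_apply] at this
    linarith
  have h1 : ∀ i j, inner ℝ (P.normal j) (x - t • P.vertex i) = t * P.slackMatrix i j := by
    intro i j
    rw [inner_sub_right, inner_smul_right, h0, slackMatrix_apply]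
    ring
  have h2 : ∀ i, x - t • P.vertex i = 0 := by
    intro i
    rcases le_total t 0 with ht | ht
    · exact P.eq_zero_of_inner_nonpos fun j ↦
        (h1 i j).trans_le (mul_nonpos_of_nonpos_of_nonneg ht (P.slackMatrix_nonneg i j))
    · refine neg_eq_zero.1 (P.eq_zero_of_inner_nonpos fun j ↦ ?_)
      rw [inner_neg_right, h1]
      exact neg_nonpos.2 (mul_nonneg ht (P.slackMatrix_nonneg i j))
  obtain ⟨j⟩ := ‹Nonempty (Fin f)›
  obtain ⟨i, hi⟩ := P.exists_slackMatrix_pos j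
  have h3 := h1 i j
  rw [h2 i, inner_zero_right] at h3
  have ht : t = 0 := (mul_eq_zero.1 h3.symm).resolve_right hi.ne'
  have hx := h2 i
  rw [ht, zero_smul, sub_zero] at hx
  rw [hx, ht]
  rfl

/-- The sum of the vertices has positive slacks. -/
theorem facetSlack_sum_pos (j : Fin f) : 0 < P.facetSlack (∑ i, P.vertex i, (v : ℝ)) j := by
  have h : P.facetSlack (∑ i, P.vertex i, (v : ℝ)) j = ∑ i, P.slackMatrix i j := by
    simp [facetSlack_apply, slackMatrix_apply, inner_sum]
  obtain ⟨i, hi⟩ := P.exists_slackMatrix_pos j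
  rw [h]
  exact Finset.sum_pos' (fun i _ ↦ P.slackMatrix_nonneg i j) ⟨i, Finset.mem_univ i, hi⟩

/-- Vertices give cocircuits: a vertex is the only point lying on all the facets through it. -/
theorem isCocircuit_row [Nonempty (Fin f)] (i : Fin v) :
    IsCocircuit (Set.range P.facetSlack) (P.slackMatrix i) := by
  refine ⟨⟨(P.vertex i, 1), P.facetSlack_vertex i⟩, P.slackMatrix_nonneg i, fun h ↦ ?_, ?_⟩
  · rw [← facetSlack_vertex] at h
    have := congrArg Prod.snd (P.facetSlack_injective (h.trans (map_zero _).symm))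
    exact one_ne_zero this
  · rintro _ ⟨⟨x, t⟩, rfl⟩ hvan
    set u := x - t • P.vertex i with hu
    have hact : ∀ j, P.slackMatrix i j = 0 → inner ℝ (P.normal j) u = 0 := by
      intro j hj
      have h1 := hvan j hj
      rw [facetSlack_apply] at h1
      rw [slackMatrix_apply] at hj
      rw [hu, inner_sub_right, inner_smul_right]
      linear_combination t * hj - h1
    -- Both `p_i + ε u` and `p_i - ε u` satisfy the facet inequalities for small `ε`.
    have hev : ∀ᶠ ε : ℝ in nhdsWithin 0 (Set.Ioi 0),
        ∀ j, |ε * inner ℝ (P.normal j) u| ≤ P.slackMatrix i j := by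
      rw [Filter.eventually_all]
      intro j
      rcases (P.slackMatrix_nonneg i j).eq_or_lt with h0 | hpos
      · refine Filter.Eventually.of_forall fun ε ↦ ?_
        rw [hact j h0.symm, ← h0, mul_zero, abs_zero]
      · have hc : Filter.Tendsto (fun ε : ℝ ↦ |ε * inner ℝ (P.normal j) u|) (nhds 0) (nhds 0) := by
          have : Continuous fun ε : ℝ ↦ |ε * inner ℝ (P.normal j) u| := by fun_prop
          simpa using this.tendsto 0
        exact ((hc.mono_left nhdsWithin_le_nhds).eventually_lt_const hpos).mono fun _ h ↦ h.le
    obtain ⟨ε, hε, hε0⟩ := (hev.and self_mem_nhdsWithin).exists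
    have hmem : ∀ σ : ℝ, |σ| = ε → P.vertex i + σ • u ∈ P.carrier := by
      intro σ hσ
      rw [mem_carrier_iff]
      intro j
      have h1 := hε j
      rw [abs_mul, ← hσ, abs_abs, ← abs_mul, slackMatrix_apply] at h1
      rw [inner_add_right, inner_smul_right]
      linarith [le_abs_self (σ * inner ℝ (P.normal j) u)]
    have hext : P.vertex i ∈ P.carrier.extremePoints ℝ := P.range_vertex ▸ ⟨i, rfl⟩
    have hseg : P.vertex i ∈ openSegment ℝ (P.vertex i + ε • u) (P.vertex i + (-ε) • u) := by
      refine ⟨1 / 2, 1 / 2, by norm_num, by norm_num, by norm_num, ?_⟩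
      module
    have hεpos : 0 < ε := hε0
    have heq := (mem_extremePoints_iff_left.1 hext).2 _ (hmem ε (abs_of_pos hεpos)) _
      (hmem (-ε) (by rw [abs_neg, abs_of_pos hεpos])) hseg
    have hu0 : u = 0 := (smul_eq_zero.1 (add_eq_left.1 heq)).resolve_left hεpos.ne'
    refine ⟨t, ?_⟩
    rw [← facetSlack_vertex, ← map_smul, Prod.smul_mk, smul_eq_mul, mul_one, ← sub_eq_zero.1 hu0]

/-- Cocircuits come from vertices: after dehomogenization `(x, t)` is a point of the polytope, and any
segment around it stays on the facets through it, hence is trivial. -/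
theorem exists_row_of_isCocircuit [Nonempty (Fin f)] {y : Fin f → ℝ}
    (hy : IsCocircuit (Set.range P.facetSlack) y) :
    ∃ i, ∀ j, P.slackMatrix i j = 0 ↔ y j = 0 := by
  obtain ⟨⟨x, t⟩, rfl⟩ := hy.mem
  have hv : (0 : ℝ) < v := by
    obtain ⟨i⟩ := P.nonempty_vertex
    exact_mod_cast i.pos
  -- Otherwise `(x, t)` plus a multiple of the sum of the vertices is a direction of recession.
  have ht : 0 < t := by
    by_contra! ht
    set c := -t / v
    have hc : 0 ≤ c := div_nonneg (neg_nonneg.2 ht) hv.le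
    have hsum : (x, t) + c • ((∑ i, P.vertex i, (v : ℝ)) : EuclideanSpace ℝ (Fin d) × ℝ) =
        (x + c • ∑ i, P.vertex i, 0) := by
      refine Prod.ext rfl ?_
      simp [c, hv.ne']
    have hval : ∀ j, P.facetSlack (x, t) j + c * P.facetSlack (∑ i, P.vertex i, (v : ℝ)) j =
        - inner ℝ (P.normal j) (x + c • ∑ i, P.vertex i) := by
      intro j
      have := congrFun (congrArg P.facetSlack hsum) j
      rw [map_add, map_smul, facetSlack_apply (t := 0), zero_mul, zero_sub] at this
      exact this
    have hz : x + c • ∑ i, P.vertex i = 0 := P.eq_zero_of_inner_nonpos fun j ↦ by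
      have := add_nonneg (hy.nonneg j) (mul_nonneg hc (P.facetSlack_sum_pos j).le)
      rw [hval] at this
      exact neg_nonneg.1 this
    refine hy.ne_zero (funext fun j ↦ le_antisymm ?_ (hy.nonneg j))
    have := hval j
    rw [hz, inner_zero_right, neg_zero] at this
    have h2 := mul_nonneg hc (P.facetSlack_sum_pos j).le
    rw [Pi.zero_apply]
    linarith
  have hslack : ∀ j, P.facetSlack (x, t) j = t * (P.offset j - inner ℝ (P.normal j) (t⁻¹ • x)) := by
    intro j
    rw [facetSlack_apply, inner_smul_right]
    field_simp
  have hmem : t⁻¹ • x ∈ P.carrier := by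
    rw [mem_carrier_iff]
    intro j
    have := hy.nonneg j
    rw [hslack] at this
    exact sub_nonneg.1 (nonneg_of_mul_nonneg_right this ht)
  have hext : t⁻¹ • x ∈ P.carrier.extremePoints ℝ := by
    refine mem_extremePoints_iff_left.2 ⟨hmem, fun a ha b hb hab ↦ ?_⟩
    obtain ⟨r, s, hr, hs, hrs, hp⟩ := hab
    obtain ⟨q, hq⟩ := hy.eq_smul _ ⟨(a, 1), rfl⟩ fun j hj ↦ by
      rw [hslack] at hj
      have h1 := (mul_eq_zero.1 hj).resolve_left ht.ne'
      rw [← hp, inner_add_right, inner_smul_right, inner_smul_right] at h1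
      have ha' := P.inner_le_offset j a ha
      have hb' := P.inner_le_offset j b hb
      rw [facetSlack_apply, one_mul]
      have h2 : r * (P.offset j - inner ℝ (P.normal j) a) +
          s * (P.offset j - inner ℝ (P.normal j) b) = 0 := by
        linear_combination h1 + (P.offset j) * hrs
      have h3 := mul_nonneg hr.le (sub_nonneg.2 ha')
      have h4 := mul_nonneg hs.le (sub_nonneg.2 hb')
      exact (mul_eq_zero.1
        (by linarith : r * (P.offset j - inner ℝ (P.normal j) a) = 0)).resolve_left hr.ne'
    rw [← map_smul] at hq
    have h5 := P.facetSlack_injective hq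
    have h6 : a = q • x := congrArg Prod.fst h5
    have h7 : 1 = q * t := congrArg Prod.snd h5
    rw [h6, eq_inv_of_mul_eq_one_left h7.symm]
  rw [← P.range_vertex] at hext
  obtain ⟨i, hi⟩ := hext
  refine ⟨i, fun j ↦ ?_⟩
  rw [hslack, slackMatrix_apply, hi]
  simp [ht.ne']

end LabelledPolytope

/-! ### Polytopes with `d + 2` vertices or facets -/

namespace LabelledPolytope

variable {d v f : ℕ}

theorem finrank_homogeneous : Module.finrank ℝ (EuclideanSpace ℝ (Fin d) × ℝ) = d + 1 := by
  rw [Module.finrank_prod, finrank_euclideanSpace_fin, Module.finrank_self]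

/-- Here `l` is the affine dependence of the vertices. -/
theorem exists_isCircuitPattern_of_vertices (P : LabelledPolytope d (d + 2) f) :
    ∃ l, IsCircuitPattern (fun i j ↦ P.slackMatrix i j ≠ 0) l := by
  have hd : 0 < d := by
    rcases Nat.eq_zero_or_pos d with rfl | h
    · exact absurd (P.vertex_injective (Subsingleton.elim (P.vertex 0) (P.vertex 1))) (by decide)
    · exact h
  obtain ⟨l, hl, hL⟩ := exists_range_eq_dotProduct_eq_zero P.vertexSlack P.vertexSlack_injective
    (by rw [finrank_homogeneous, Fintype.card_fin])
  exact ⟨l, isCircuitPattern_of_isCocircuit hl (L := Set.range P.vertexSlack) hL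
    ⟨_, ⟨(0, 1), rfl⟩, fun i ↦ by simp [vertexSlack_apply]⟩ _ P.isCocircuit_column
    fun y hy ↦ P.exists_column_of_isCocircuit hd hy⟩

/-- Here `l` is the linear dependence of the facet inequalities `(W_j, w_j)`. -/
theorem exists_isCircuitPattern_of_facets (P : LabelledPolytope d v (d + 2)) :
    ∃ l, IsCircuitPattern (fun j i ↦ P.slackMatrix i j ≠ 0) l := by
  obtain ⟨l, hl, hL⟩ := exists_range_eq_dotProduct_eq_zero P.facetSlack P.facetSlack_injective
    (by rw [finrank_homogeneous, Fintype.card_fin])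
  exact ⟨l, isCircuitPattern_of_isCocircuit hl (L := Set.range P.facetSlack) hL
    ⟨_, ⟨(∑ i, P.vertex i, (v : ℝ)), rfl⟩, P.facetSlack_sum_pos⟩ (fun j i ↦ P.slackMatrix i j)
    P.isCocircuit_row fun y hy ↦ P.exists_row_of_isCocircuit hy⟩

theorem slackIdeal_eq_of_vertices (P : LabelledPolytope d (d + 2) f) :
    P.slackIdeal = P.graphToricIdeal := by
  obtain ⟨l, hl⟩ := P.exists_isCircuitPattern_of_vertices
  refine le_antisymm (P.slackIdeal_le_graphToricIdeal fun r c ↦ ?_)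
    (P.graphToricIdeal_le_slackIdeal fun A _ M hunit hzero hdet ↦
      hl.exists_units_mul hunit hzero (det_submatrix_id_eq_zero M fun c ↦ ?_))
  · rw [orderEmbedding_fin_eq_id r]
    classical
    convert hl.det_submatrix_indicator c
    rfl
  · exact hdet (RelEmbedding.refl _) c

theorem slackIdeal_eq_of_facets (P : LabelledPolytope d v (d + 2)) :
    P.slackIdeal = P.graphToricIdeal := by
  obtain ⟨l, hl⟩ := P.exists_isCircuitPattern_of_facets
  refine le_antisymm (P.slackIdeal_le_graphToricIdeal fun r c ↦ ?_)
    (P.graphToricIdeal_le_slackIdeal fun A _ M hunit hzero hdet ↦ ?_)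
  · rw [orderEmbedding_fin_eq_id c, ← det_transpose]
    classical
    convert hl.det_submatrix_indicator r
    ext i j
    simp
  · obtain ⟨s, t, h⟩ := hl.exists_units_mul (M := Mᵀ) (fun j i ↦ hunit i j) (fun j i ↦ hzero i j)
      (det_submatrix_id_eq_zero Mᵀ fun r ↦ by
        rw [← hdet r (RelEmbedding.refl _), ← det_transpose]
        rfl)
    exact ⟨t, s, fun i j hij ↦ by rw [mul_comm]; exact h j i hij⟩

end LabelledPolytope

theorem mainTheorem5 (d v f : ℕ) (P : LabelledPolytope d v f) (h : v = d + 2 ∨ f = d + 2) :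
    P.slackIdeal = P.graphToricIdeal ∧ P.IsGraphic ∧ IsToric P.slackIdeal := by
  have heq : P.slackIdeal = P.graphToricIdeal := by
    rcases h with rfl | rfl
    · exact P.slackIdeal_eq_of_vertices
    · exact P.slackIdeal_eq_of_facets
  exact ⟨heq, heq, heq ▸ isToric_toricIdeal P.incidenceMatrix⟩
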